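/- **Setting.** A gMDP $\mathbf M=(\mathbb X,\mathbb U,\mathbb Y,x_0,\mathbf t,h)$ has Polish state and input spaces $\mathbb X,\mathbb U$, a metric output space $(\mathbb Y,\mathbf d)$, an initial state $x_0\in\mathbb X$, a Borel stochastic kernel $\mathbf t(\cdot\mid x,u)$ on $\mathbb X$ and a measurable output map $h:\mathbb X\to\mathbb Y$; for a probability measure $\nu$ on $\mathbb U$ put $\mathbf t(\cdot\mid x,\nu)=\int\mathbf t(\cdot\mid x,u)\,\nu(du)$. A control strategy $\mathbf C$ for $\mathbf M$ consists of a Polish memory space $\mathbb X_{\mathbf C}$, an initial memory $c_0$, a universally measurable stochastic kernel $\mathbf t_{\mathbf C}(\cdot\mid c,x)$ on $\mathbb X_{\mathbf C}$ and a universally measurable map $h_{\mathbf C}$ from $\mathbb X_{\mathbf C}$ to the probability measures on $\mathbb U$. The execution of $\mathbf C\times\mathbf M$ starts at $(x_0,c_0)$ and is generated by $c_{t+1}\sim\mathbf t_{\mathbf C}(\cdot\mid c_t,x_t)$, $u_t\sim h_{\mathbf C}(c_{t+1})$, $x_{t+1}\sim\mathbf t(\cdot\mid x_t,u_t)$. Let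 $AP$ be a finite set, $\mathsf L:\mathbb Y\to 2^{AP}$ a measurable labelling and $\psi$ an scLTL formula over $AP$ (built from $p,\neg p,\wedge,\vee,\bigcirc,\mathsf U$). $\mathbb P_{\mathbf C\times\mathbf M}(\boldsymbol\omega\models\psi)$ is the probability that $\boldsymbol\omega=(\mathsf L(h(x_t)))_{t\ge0}$ satisfies $\psi$. For $\epsilon,\delta\ge0$ write $\mathbf M\preceq^\delta_\epsilon\widehat{\mathbf M}$, where $\widehat{\mathbf M}=(\hat{\mathbb X},\hat{\mathbb U},\mathbb Y,\hat x_0,\hat{\mathbf t},\hat h)$, if there are a measurable relation $\mathcal R\subseteq\mathbb X\times\hat{\mathbb X}$ with $(x_0,\hat x_0)\in\mathcal R$, a map $\mathcal U_v$ from $\mathbb U\times\mathbb X\times\hat{\mathbb X}$ to the probability measures on $\hat{\mathbb U}$, and a Borel stochastic kernel $\mathbb W(\cdot\mid u,x,\hat x)$ on $\mathbb X\times\hat{\mathbb X}$ such that for all $(x,\hat x)\in\mathcal R$: $\mathbf d(h(x),\hat h(\hat x))\le\epsilon$, and for all $u\in\mathbb U$ the measure $\mathbb W(\cdot\mid u,x,\hat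 x)$ has marginals $\mathbf t(\cdot\mid x,u)$ and $\hat{\mathbf t}(\cdot\mid\hat x,\mathcal U_v(u,x,\hat x))$ and satisfies $\mathbb W(\mathcal R\mid u,x,\hat x)\ge1-\delta$. Let $\mathcal A_\psi=(Q,q_0,2^{AP},F,\tau)$ be a finite deterministic automaton such that $\boldsymbol\omega\models\psi$ if and only if the run of $\mathcal A_\psi$ on $\boldsymbol\omega$ from $q_0$ visits $F$ (at some time $n\ge0$), and such that $\tau(q_0,\alpha)\in F$ for all letters $\alpha$ in case $q_0\in F$. Put $\bar\tau(q,\hat x)=\{\tau(q,\mathsf L(y)):\ y\in\mathbb Y,\ \mathbf d(y,\hat h(\hat x))\le\epsilon\}$ and $\mathbf{L}(a)=\min(1,\max(0,a))$. For $V:\hat{\mathbb X}\times Q\to[0,1]$ the $(\epsilon,\delta)$-optimistic operator is $$\mathbf T^*_{-\epsilon,-\delta}(V)(\hat x,q)=\sup_\mu \mathbf L\Big(\int_{\hat{\mathbb X}}\ \max_{q'\in\bar\tau(q,\hat x')}\max\{\mathbf 1_F(q'),V(\hat x',q')\}\ \hat{\mathbf t}(d\hat x'\mid\hat x,\mu(\hat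 x,q))+\delta\Big),$$ the supremum being over the universally measurable maps $\mu$ from $\hat{\mathbb X}\times Q$ to the probability measures on $\hat{\mathbb U}$ (for an integrand that is not universally measurable, the integral is the supremum of the integrals of its measurable minorants). The sequence $(\mathbf T^*_{-\epsilon,-\delta})^l(0)$ is nondecreasing in $l$; let $V_\infty$ be its pointwise limit, and define the optimistic value $$\mathcal S^*_{-\epsilon,-\delta}=\max_{\bar q_0\in\bar\tau(q_0,\hat x_0)}\max\{\mathbf 1_F(\bar q_0),V_\infty(\hat x_0,\bar q_0)\}.$$ **Theorem.** For every gMDP $\mathbf M$ with output space $\mathbb Y$ and $\mathbf M\preceq^\delta_\epsilon\widehat{\mathbf M}$, and for every control strategy $\mathbf C$ for $\mathbf M$, $$\mathbb P_{\mathbf C\times\mathbf M}(\boldsymbol\omega\models\psi)\le\mathcal S^*_{-\epsilon,-\delta}.$$ That is, every control strategy $\hat{\mathbf C}$ for $\widehat{\mathbf M}$, in particular any strategy computed from $\mathbf T^*_{-\epsilon,-\delta}$, $(\epsilon,\delta)$-optimistically satisfies $\psi$ with probability $\mathcal S^*_{-\epsilon,-\delta}$ (the condition in the definition of optimistic satisfaction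 does not depend on $\hat{\mathbf C}$). -/

import Mathlib

open MeasureTheory ProbabilityTheory Filter Topology Set
open scoped ENNReal NNReal

universe u₁ u₂ u₃ u₄ u₅ u₆ u₇ u₈ u₉

noncomputable section

/-! ### Universal measurability -/

/-- A copy of `α`, carrying the σ-algebra of universally measurable sets of `α`, i.e. of the sets
that are measurable for the completion of every finite measure on `α`. -/
def UnivMeas (α : Type*) : Type _ := α

/-- The identity `α → UnivMeas α`. -/
def UnivMeas.mk {α : Type*} (a : α) : UnivMeas α := a

/-- The identity `UnivMeas α → α`. -/
def UnivMeas.val {α : Type*} (a : UnivMeas α) : α := a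

/-- The map `f`, seen as a map on the copies. -/
def UnivMeas.map {α β : Type*} (f : α → β) (a : UnivMeas α) : UnivMeas β := UnivMeas.mk (f a.val)

instance UnivMeas.instMeasurableSpace (α : Type*) [MeasurableSpace α] :
    MeasurableSpace (UnivMeas α) where
  MeasurableSet' s :=
    ∀ μ : Measure α, IsFiniteMeasure μ → NullMeasurableSet (UnivMeas.mk ⁻¹' s) μ
  measurableSet_empty := fun _ _ => nullMeasurableSet_empty
  measurableSet_compl := fun _ hs μ hμ => (hs μ hμ).compl
  measurableSet_iUnion := fun f hf μ hμ => by
    rw [preimage_iUnion]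
    exact NullMeasurableSet.iUnion fun i => hf i μ hμ

theorem UnivMeas.measurableSet_iff {α : Type*} [MeasurableSpace α] {s : Set (UnivMeas α)} :
    MeasurableSet s ↔
      ∀ μ : Measure α, IsFiniteMeasure μ → NullMeasurableSet (UnivMeas.mk ⁻¹' s) μ := Iff.rfl

/-- Every (Borel) measurable map between `α` and `β` is measurable for the σ-algebras of
universally measurable sets. -/
theorem UnivMeas.measurable_map {α β : Type*} [MeasurableSpace α] [MeasurableSpace β] {f : α → β}
    (hf : Measurable f) : Measurable (UnivMeas.map f) := by
  intro s hs
  rw [UnivMeas.measurableSet_iff]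
  intro μ hμ
  exact NullMeasurableSet.preimage (f := f) (UnivMeas.measurableSet_iff.1 hs (μ.map f) inferInstance)
    ⟨hf, Measure.AbsolutelyContinuous.rfl⟩

theorem UnivMeas.measurable_val {α : Type*} [MeasurableSpace α] :
    Measurable (UnivMeas.val : UnivMeas α → α) := by
  intro s hs
  rw [UnivMeas.measurableSet_iff]
  intro μ _
  exact MeasurableSet.nullMeasurableSet (μ := μ) hs

/-- The unique extension of a finite measure to the universally measurable sets. -/
def UnivMeas.extend {α : Type*} [MeasurableSpace α] (μ : Measure α) [hμ : IsFiniteMeasure μ] :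
    Measure (UnivMeas α) :=
  Measure.ofMeasurable (fun s _ => μ (UnivMeas.mk ⁻¹' s)) measure_empty
    (fun f hf hd => by
      rw [preimage_iUnion]
      exact measure_iUnion₀ (fun _ _ hij => ((hd hij).preimage UnivMeas.mk).aedisjoint)
        fun i => UnivMeas.measurableSet_iff.1 (hf i) μ hμ)

theorem UnivMeas.extend_apply {α : Type*} [MeasurableSpace α] (μ : Measure α) [IsFiniteMeasure μ]
    {s : Set (UnivMeas α)} (hs : MeasurableSet s) :
    UnivMeas.extend μ s = μ (UnivMeas.mk ⁻¹' s) :=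
  Measure.ofMeasurable_apply s hs

/-- If `κ` is a universally measurable stochastic kernel and `s` is a universally measurable subset
of the product, then `a ↦ κ a {b | (a, b) ∈ s}` is universally measurable. -/
theorem UnivMeas.measurable_kernel_section {α β : Type*} [MeasurableSpace α] [MeasurableSpace β]
    (κ : Kernel (UnivMeas α) β) [IsMarkovKernel κ] {s : Set (UnivMeas (α × β))}
    (hs : MeasurableSet s) :
    Measurable (fun a : UnivMeas α => κ a {b : β | UnivMeas.mk (a.val, b) ∈ s}) := by
  have hid : Measurable (fun p : UnivMeas α × β => (p.1.val, p.2)) :=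
    (UnivMeas.measurable_val.comp measurable_fst).prodMk measurable_snd
  intro B hB
  rw [UnivMeas.measurableSet_iff]
  intro μ hμ
  have hfe : IsFiniteMeasure (UnivMeas.extend μ) :=
    ⟨by rw [UnivMeas.extend_apply μ MeasurableSet.univ]; exact measure_lt_top μ _⟩
  let ρ : Measure (α × β) :=
    ((UnivMeas.extend μ) ⊗ₘ κ).map (fun p : UnivMeas α × β => (p.1.val, p.2))
  have hρ : IsFiniteMeasure ρ := by dsimp only [ρ]; infer_instance
  obtain ⟨t, _, ht, hst⟩ :=
    (UnivMeas.measurableSet_iff.1 hs ρ hρ).exists_measurable_superset_ae_eq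
  have hg : Measurable (fun a : UnivMeas α => κ a {b : β | (a.val, b) ∈ t}) :=
    Kernel.measurable_kernel_prodMk_left (κ := κ) (hid ht)
  have hg' : NullMeasurable (fun a : α => κ (UnivMeas.mk a) {b : β | (a, b) ∈ t}) μ :=
    fun A hA => UnivMeas.measurableSet_iff.1 (hg hA) μ hμ
  have h1 : ∀ᵐ p ∂((UnivMeas.extend μ) ⊗ₘ κ),
      ((p.1.val, p.2) ∈ t) = ((p.1.val, p.2) ∈ UnivMeas.mk ⁻¹' s) :=
    ae_of_ae_map hid.aemeasurable hst
  have h3 : ∀ᵐ a ∂(UnivMeas.extend μ), κ a {b : β | (a.val, b) ∈ t} =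
      κ a {b : β | UnivMeas.mk (a.val, b) ∈ s} := by
    filter_upwards [Measure.ae_ae_of_ae_compProd h1] with a ha
    exact measure_congr ha
  obtain ⟨N, hN, hNm, hN0⟩ := exists_measurable_superset_of_null h3
  rw [UnivMeas.extend_apply μ hNm] at hN0
  have h4 : (fun a : α => κ (UnivMeas.mk a) {b : β | (a, b) ∈ t}) =ᵐ[μ]
      (fun a : α => κ (UnivMeas.mk a) {b : β | UnivMeas.mk (a, b) ∈ s}) :=
    measure_mono_null (μ := μ) (fun a ha => hN ha) hN0
  exact hg'.congr h4 hB

/-- For a universally measurable stochastic kernel `κ` from `α` to `β`, the kernel that maps `a` to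
the law of `(a, b)` with `b ∼ κ a`, extended to the universally measurable sets. -/
def UnivMeas.graph {α β : Type*} [MeasurableSpace α] [MeasurableSpace β]
    (κ : Kernel (UnivMeas α) β) [IsMarkovKernel κ] : Kernel (UnivMeas α) (UnivMeas (α × β)) where
  toFun a := UnivMeas.extend ((κ a).map (fun b => (a.val, b)))
  measurable' := by
    refine Measure.measurable_of_measurable_coe _ fun s hs => ?_
    convert UnivMeas.measurable_kernel_section κ hs using 2 with a
    rw [UnivMeas.extend_apply _ hs]
    exact Measure.map_apply₀ measurable_prodMk_left.aemeasurable
      (UnivMeas.measurableSet_iff.1 hs _ inferInstance)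

instance UnivMeas.isMarkovKernel_graph {α β : Type*} [MeasurableSpace α] [MeasurableSpace β]
    (κ : Kernel (UnivMeas α) β) [IsMarkovKernel κ] : IsMarkovKernel (UnivMeas.graph κ) where
  isProbabilityMeasure a := ⟨by
    have h : IsProbabilityMeasure ((κ a).map (fun b => (a.val, b))) :=
      Measure.isProbabilityMeasure_map measurable_prodMk_left.aemeasurable
    exact (UnivMeas.extend_apply ((κ a).map (fun b => (a.val, b)))
      MeasurableSet.univ).trans h.measure_univ⟩

/-- The extension of the measures `κ a` of a universally measurable stochastic kernel `κ` to the
universally measurable sets. -/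
def UnivMeas.lift {α β : Type*} [MeasurableSpace α] [MeasurableSpace β]
    (κ : Kernel (UnivMeas α) β) [IsMarkovKernel κ] : Kernel (UnivMeas α) (UnivMeas β) :=
  (UnivMeas.graph κ).map (UnivMeas.map Prod.snd)

instance UnivMeas.isMarkovKernel_lift {α β : Type*} [MeasurableSpace α] [MeasurableSpace β]
    (κ : Kernel (UnivMeas α) β) [IsMarkovKernel κ] : IsMarkovKernel (UnivMeas.lift κ) :=
  Kernel.IsMarkovKernel.map _ (UnivMeas.measurable_map measurable_snd)

/-! ### General Markov decision processes and control strategies -/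

/-- A general Markov decision process with state space `X`, input space `U`, output space `Y`:
initial state, Borel measurable stochastic transition kernel, measurable output map. -/
structure GMDP (X U Y : Type*) [MeasurableSpace X] [MeasurableSpace U] [MeasurableSpace Y] where
  init : X
  trans : Kernel (X × U) X
  markov_trans : IsMarkovKernel trans
  out : X → Y
  measurable_out : Measurable out

attribute [instance] GMDP.markov_trans

/-- The distribution `t(· | x, ν)` of the next state when the input is drawn from `ν`. -/
def GMDP.transMeas {X U Y : Type*} [MeasurableSpace X] [MeasurableSpace U] [MeasurableSpace Y]
    (M : GMDP X U Y) (x : X) (ν : Measure U) : Measure X :=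
  ν.bind fun u => M.trans (x, u)

/-- A control strategy with memory space `XC`, for processes with state space `X` and input space
`U`: initial memory state, universally measurable kernel updating the memory from the present memory
and the state of the process, and universally measurable map from the memory to the probability
measures on `U`. -/
structure ControlStrategy (X U XC : Type*) [MeasurableSpace X] [MeasurableSpace U]
    [MeasurableSpace XC] where
  init : XC
  trans : Kernel (UnivMeas (XC × X)) XC
  markov_trans : IsMarkovKernel trans
  out : Kernel (UnivMeas XC) U
  markov_out : IsMarkovKernel out

attribute [instance] ControlStrategy.markov_trans ControlStrategy.markov_out

namespace ControlStrategy

variable {X U Y XC : Type*} [MeasurableSpace X] [MeasurableSpace U] [MeasurableSpace Y]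
  [MeasurableSpace XC]

/-- The update of the memory, as a kernel on the joint state space: from `(x, c)` draw the new
memory state from `trans (c, x)`. -/
def memoryKernel (C : ControlStrategy X U XC) : Kernel (UnivMeas (X × XC)) XC :=
  C.trans.comap (UnivMeas.map Prod.swap) (UnivMeas.measurable_map measurable_swap)

instance (C : ControlStrategy X U XC) : IsMarkovKernel C.memoryKernel :=
  Kernel.IsMarkovKernel.comap C.trans (UnivMeas.measurable_map measurable_swap)

/-- The input drawn from `out c'` at `((x, c), c')`. -/
def inputKernel (C : ControlStrategy X U XC) : Kernel (UnivMeas ((X × XC) × XC)) U :=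
  C.out.comap (UnivMeas.map Prod.snd) (UnivMeas.measurable_map measurable_snd)

instance (C : ControlStrategy X U XC) : IsMarkovKernel C.inputKernel :=
  Kernel.IsMarkovKernel.comap C.out (UnivMeas.measurable_map measurable_snd)

/-- From `((x, c), c')` draw an input `u` from `out c'` and then the next state from
`M.trans (x, u)`. -/
def stateKernel (C : ControlStrategy X U XC) (M : GMDP X U Y) :
    Kernel (UnivMeas ((X × XC) × XC)) X :=
  M.trans ∘ₖ
    ((Kernel.deterministic (fun p => p.val.1.1)
        ((measurable_fst.comp measurable_fst).comp UnivMeas.measurable_val)) ×ₖ C.inputKernel)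

instance (C : ControlStrategy X U XC) (M : GMDP X U Y) : IsMarkovKernel (C.stateKernel M) := by
  unfold stateKernel
  infer_instance

/-- One step of the controlled process: from `(x, c)` draw `c' ∼ trans (c, x)`, then
`u ∼ out c'`, then `x' ∼ M.trans (x, u)`; the new joint state is `(x', c')`. -/
def stepKernel (C : ControlStrategy X U XC) (M : GMDP X U Y) :
    Kernel (UnivMeas (X × XC)) (X × XC) :=
  ((C.stateKernel M) ×ₖ
      (Kernel.deterministic (fun p => p.val.2) (measurable_snd.comp UnivMeas.measurable_val))) ∘ₖ
    UnivMeas.graph C.memoryKernel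

instance (C : ControlStrategy X U XC) (M : GMDP X U Y) : IsMarkovKernel (C.stepKernel M) := by
  unfold stepKernel
  infer_instance

/-- The law of the execution `(x_t, c_t)`, `t = 0, 1, 2, …`, of the process `M` controlled by `C`,
started at the two initial states (Ionescu-Tulcea). -/
def law (C : ControlStrategy X U XC) (M : GMDP X U Y) : Measure (ℕ → UnivMeas (X × XC)) :=
  Kernel.trajMeasure (X := fun _ => UnivMeas (X × XC))
    (Measure.dirac (UnivMeas.mk (M.init, C.init)))
    (fun n => (UnivMeas.lift (C.stepKernel M)).comap
      (fun h : (Π _ : Finset.Iic n, UnivMeas (X × XC)) => h ⟨n, Finset.mem_Iic.2 le_rfl⟩)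
      (measurable_pi_apply _))

end ControlStrategy

/-! ### Specifications -/

/-- Syntactically co-safe LTL formulas. -/
inductive ScLTL (AP : Type*) where
  | atom (p : AP) : ScLTL AP
  | natom (p : AP) : ScLTL AP
  | and (ψ₁ ψ₂ : ScLTL AP) : ScLTL AP
  | or (ψ₁ ψ₂ : ScLTL AP) : ScLTL AP
  | next (ψ : ScLTL AP) : ScLTL AP
  | until (ψ₁ ψ₂ : ScLTL AP) : ScLTL AP

/-- `ψ.Sat ω t`: the suffix of the word `ω` that starts at time `t` satisfies `ψ`. -/
def ScLTL.Sat {AP : Type*} : ScLTL AP → (ℕ → Set AP) → ℕ → Prop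
  | .atom p, ω, t => p ∈ ω t
  | .natom p, ω, t => p ∉ ω t
  | .and ψ₁ ψ₂, ω, t => ψ₁.Sat ω t ∧ ψ₂.Sat ω t
  | .or ψ₁ ψ₂, ω, t => ψ₁.Sat ω t ∨ ψ₂.Sat ω t
  | .next ψ, ω, t => ψ.Sat ω (t + 1)
  | .until ψ₁ ψ₂, ω, t => ∃ i, ψ₂.Sat ω (t + i) ∧ ∀ j < i, ψ₁.Sat ω (t + j)

/-- The location of the automaton after reading the first `n` letters of the word `ω`. -/
def DFA.run {α Q : Type*} (A : DFA α Q) (ω : ℕ → α) : ℕ → Q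
  | 0 => A.start
  | n + 1 => A.step (A.run ω n) (ω n)

/-- The automaton accepts the infinite words with a finite run that ends in an accepting location,
and these are exactly the words that satisfy `ψ`. -/
def DFA.Recognizes {AP Q : Type*} (A : DFA (Set AP) Q) (ψ : ScLTL AP) : Prop :=
  ∀ ω : ℕ → Set AP, ψ.Sat ω 0 ↔ ∃ n, A.run ω n ∈ A.accept

/-- The probability that the output traces of `M` under the strategy `C`, labelled by `L`,
satisfy `ψ`. -/
def ControlStrategy.satProb {X U Y XC AP : Type*} [MeasurableSpace X] [MeasurableSpace U]
    [MeasurableSpace Y] [MeasurableSpace XC] (C : ControlStrategy X U XC) (M : GMDP X U Y)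
    (L : Y → Set AP) (ψ : ScLTL AP) : ℝ≥0∞ :=
  C.law M {z | ψ.Sat (fun t => L (M.out (z t).val.1)) 0}

/-! ### Approximate simulation -/

/-- `W` is a lifting witnessing that `(Δ, Θ)` is in the `δ`-lifted relation of `R`. -/
structure IsLifting {X₁ X₂ : Type*} [MeasurableSpace X₁] [MeasurableSpace X₂] (R : Set (X₁ × X₂))
    (δ : ℝ≥0) (W : Measure (X₁ × X₂)) (Δ : Measure X₁) (Θ : Measure X₂) : Prop where
  left : ∀ A : Set X₁, MeasurableSet A → W (A ×ˢ univ) = Δ A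
  right : ∀ A : Set X₂, MeasurableSet A → W (univ ×ˢ A) = Θ A
  rel : 1 - (δ : ℝ≥0∞) ≤ W R

/-- `M₁ ⪯ M₂` with precision `(ε, δ)`: `M₁` is `(ε, δ)`-stochastically simulated by `M₂`. -/
def StochSimulated {X₁ U₁ X₂ U₂ Y : Type*} [MeasurableSpace X₁] [MeasurableSpace U₁]
    [MeasurableSpace X₂] [MeasurableSpace U₂] [MetricSpace Y] [MeasurableSpace Y]
    (M₁ : GMDP X₁ U₁ Y) (M₂ : GMDP X₂ U₂ Y) (ε δ : ℝ≥0) : Prop :=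
  ∃ (I : U₁ × X₁ × X₂ → ProbabilityMeasure U₂) (R : Set (X₁ × X₂))
    (W : Kernel (U₁ × X₁ × X₂) (X₁ × X₂)),
    IsMarkovKernel W ∧ MeasurableSet R ∧ (M₁.init, M₂.init) ∈ R ∧
      ∀ x₁ x₂, (x₁, x₂) ∈ R →
        dist (M₁.out x₁) (M₂.out x₂) ≤ ε ∧
        ∀ u₁ : U₁, IsLifting R δ (W (u₁, x₁, x₂)) (M₁.trans (x₁, u₁))
          (M₂.transMeas x₂ (I (u₁, x₁, x₂) : Measure U₂))

/-- The strategy `C'` for `M'` satisfies `ψ` `(ε, δ)`-optimistically with probability `p`: for every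
process `M` (on Polish spaces) that is `(ε, δ)`-stochastically simulated by `M'` and every control
strategy for `M`, the probability that `ψ` is satisfied is at most `p`. (As in the usual definition,
the condition does not depend on `C'`.) -/
def OptimisticallySatisfies {X' : Type u₁} {U' : Type u₂}
    {XC' : Type u₃} {Y : Type u₄} {AP : Type u₅}
    [MeasurableSpace X'] [MeasurableSpace U'] [MeasurableSpace XC'] [MetricSpace Y]
    [MeasurableSpace Y] (M' : GMDP X' U' Y) (_C' : ControlStrategy X' U' XC')
    (L : Y → Set AP) (ψ : ScLTL AP) (ε δ : ℝ≥0) (p : ℝ≥0∞) : Prop :=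
  ∀ (X : Type u₆) [TopologicalSpace X] [PolishSpace X] [MeasurableSpace X] [BorelSpace X]
    (U : Type u₇) [TopologicalSpace U] [PolishSpace U] [MeasurableSpace U] [BorelSpace U]
    (M : GMDP X U Y), StochSimulated M M' ε δ →
    ∀ (XC : Type u₈) [TopologicalSpace XC] [PolishSpace XC] [MeasurableSpace XC] [BorelSpace XC]
      (C : ControlStrategy X U XC), C.satProb M L ψ ≤ p

/-! ### The optimistic operator -/

/-- The locations `τ(q, α)` with `α` the label of an output within distance `ε` of `y`. -/
def DFA.ambiguousStep {AP Q Y : Type*} [MetricSpace Y] (A : DFA (Set AP) Q) (L : Y → Set AP)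
    (ε : ℝ≥0) (q : Q) (y : Y) : Set Q :=
  A.step q '' (L '' Metric.closedBall y ε)

/-- `max (1_F q, v)`. -/
def DFA.acceptOr {α Q : Type*} (A : DFA α Q) (q : Q) (v : ℝ≥0∞) : ℝ≥0∞ :=
  max (A.accept.indicator 1 q) v

/-- The truncation to `[0, 1]` of a nonnegative number. -/
def truncOne (a : ℝ≥0∞) : ℝ≥0∞ := min 1 a

namespace GMDP

variable {X U Y AP Q : Type*} [MeasurableSpace X] [MeasurableSpace U] [MetricSpace Y]
  [MeasurableSpace Y] [MeasurableSpace Q]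

/-- The optimistic operator of a policy `μ`, a universally measurable map from `X × Q` to the
probability measures on `U`. The integral `∫⁻` is the Lebesgue integral of a nonnegative function,
also for integrands that are only universally measurable. -/
def optimisticPolicyOp (M : GMDP X U Y) (A : DFA (Set AP) Q) (L : Y → Set AP) (ε δ : ℝ≥0)
    (μ : Kernel (UnivMeas (X × Q)) U) (V : X → Q → ℝ≥0∞) (x : X) (q : Q) : ℝ≥0∞ :=
  truncOne ((∫⁻ x', ⨆ q' ∈ A.ambiguousStep L ε q (M.out x'), A.acceptOr q' (V x' q')
    ∂(M.transMeas x (μ (UnivMeas.mk (x, q))))) + δ)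

/-- The optimistic operator: the supremum over all policies. -/
def optimisticOp (M : GMDP X U Y) (A : DFA (Set AP) Q) (L : Y → Set AP) (ε δ : ℝ≥0)
    (V : X → Q → ℝ≥0∞) (x : X) (q : Q) : ℝ≥0∞ :=
  ⨆ (μ : Kernel (UnivMeas (X × Q)) U) (_ : IsMarkovKernel μ),
    M.optimisticPolicyOp A L ε δ μ V x q

/-- The value iteration of the optimistic operator, started at `0`. -/
def optimisticIter (M : GMDP X U Y) (A : DFA (Set AP) Q) (L : Y → Set AP) (ε δ : ℝ≥0) (l : ℕ) :
    X → Q → ℝ≥0∞ :=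
  (M.optimisticOp A L ε δ)^[l] 0

/-- The pointwise limit of the (nondecreasing) value iteration. -/
def optimisticLimit (M : GMDP X U Y) (A : DFA (Set AP) Q) (L : Y → Set AP) (ε δ : ℝ≥0)
    (x : X) (q : Q) : ℝ≥0∞ :=
  ⨆ l, M.optimisticIter A L ε δ l x q

/-- The optimistic satisfaction probability. -/
def optimisticValue (M : GMDP X U Y) (A : DFA (Set AP) Q) (L : Y → Set AP) (ε δ : ℝ≥0) : ℝ≥0∞ :=
  ⨆ q ∈ A.ambiguousStep L ε A.start (M.out M.init),
    A.acceptOr q (M.optimisticLimit A L ε δ M.init q)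

theorem optimisticOp_mono (M : GMDP X U Y) (A : DFA (Set AP) Q) (L : Y → Set AP) (ε δ : ℝ≥0) :
    Monotone (M.optimisticOp A L ε δ) := by
  intro V W h x q
  refine iSup₂_mono fun μ _ => min_le_min le_rfl ?_
  gcongr with x'
  exact max_le_max le_rfl (h x' _)

theorem tendsto_optimisticIter (M : GMDP X U Y) (A : DFA (Set AP) Q) (L : Y → Set AP)
    (ε δ : ℝ≥0) (x : X) (q : Q) :
    Tendsto (fun l => M.optimisticIter A L ε δ l x q) atTop
      (𝓝 (M.optimisticLimit A L ε δ x q)) := by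
  have h : Monotone (M.optimisticIter A L ε δ) :=
    (M.optimisticOp_mono A L ε δ).monotone_iterate_of_le_map (fun _ _ => zero_le)
  exact tendsto_atTop_iSup fun m n hmn => h hmn x q

end GMDP

end

/-! ### Integration against extended measures -/

/-! Under a fixed strategy the pair (state, memory) is a Markov chain, and its probability of
acceptance is the limit of the probabilities of acceptance within `n` steps. These obey a backward
recursion (`DFA.reachIter`), which is compared with the optimistic value iteration: for related `x`,
`x'` and every memory `c`, the `n`-step probability at `(x, c)` is at most the `n`-th iterate at
`x'` (`reachIter_le_optimisticIter`).

In the induction step, fix the input `u` and the new memory, and integrate over the coupling `W`. On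
`R` the outputs are `ε`-close, so the location really reached is among those over which the operator
maximises, and the induction hypothesis applies. Off `R` the integrand is at most `1` and the mass
at most `δ` (`IsLifting.lintegral_le`). The bound is uniform in `u` and the memory, so it survives
averaging over the strategy's choices (`ControlStrategy.lintegral_stepKernel_le`). No strategy for
the abstract process has to be constructed.

Measurability is the delicate point: the chain is only universally measurable and the iterates need
not be measurable at all. Measurable minorants on the concrete side and lower integrals on the
abstract side suffice, because only upper bounds are needed. -/

theorem UnivMeas.lift_apply {α β : Type*} [MeasurableSpace α] [MeasurableSpace β]
    (κ : Kernel (UnivMeas α) β) [IsMarkovKernel κ] (a : UnivMeas α) {s : Set (UnivMeas β)}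
    (hs : MeasurableSet s) : UnivMeas.lift κ a s = κ a (UnivMeas.mk ⁻¹' s) := by
  have hm : Measurable (UnivMeas.map (Prod.snd : α × β → β)) :=
    UnivMeas.measurable_map measurable_snd
  rw [UnivMeas.lift, Kernel.map_apply' _ hm _ hs]
  change UnivMeas.extend ((κ a).map (fun b => (a.val, b))) _ = _
  rw [UnivMeas.extend_apply _ (hm hs)]
  exact Measure.map_apply₀ measurable_prodMk_left.aemeasurable
    (UnivMeas.measurableSet_iff.1 (hm hs) _ inferInstance)

/-- A universally measurable function has a measurable minorant with the same integral. -/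
theorem UnivMeas.exists_measurable_le_lintegral_lift {α β : Type*} [MeasurableSpace α]
    [MeasurableSpace β] (κ : Kernel (UnivMeas α) β) [IsMarkovKernel κ] (a : UnivMeas α)
    {g : UnivMeas β → ℝ≥0∞} (hg : Measurable g) :
    ∃ f : β → ℝ≥0∞, Measurable f ∧ (∀ b, f b ≤ g (UnivMeas.mk b)) ∧
      ∫⁻ b, g b ∂(UnivMeas.lift κ a) = ∫⁻ b, f b ∂(κ a) := by
  have hnull : NullMeasurable (fun b => g (UnivMeas.mk b)) (κ a) := fun s hs =>
    UnivMeas.measurableSet_iff.1 (hg hs) (κ a) inferInstance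
  obtain ⟨f₁, hf₁, hae⟩ : AEMeasurable (fun b => g (UnivMeas.mk b)) (κ a) := hnull.aemeasurable
  obtain ⟨N, hN, hNm, hN0⟩ := exists_measurable_superset_of_null (ae_iff.1 hae)
  have heq : ∀ b, b ∉ N → g (UnivMeas.mk b) = f₁ b := fun b hb => by
    by_contra h
    exact hb (hN h)
  -- `f₁` agrees with `g` off the measurable null set `N`; cutting it to zero on `N` gives a
  -- minorant everywhere and keeps the integral.
  refine ⟨Nᶜ.indicator f₁, hf₁.indicator hNm.compl, fun b => ?_, ?_⟩
  · by_cases hb : b ∈ N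
    · simp [hb]
    · simp [hb, heq b hb]
  · have hval : (UnivMeas.lift κ a).map UnivMeas.val = κ a := by
      ext s hs
      rw [Measure.map_apply UnivMeas.measurable_val hs,
        UnivMeas.lift_apply κ a (UnivMeas.measurable_val hs)]
      rfl
    have hN0' : (UnivMeas.lift κ a) (UnivMeas.val ⁻¹' N) = 0 := by
      rw [← Measure.map_apply UnivMeas.measurable_val hNm, hval, hN0]
    conv_rhs => rw [← hval, lintegral_map (hf₁.indicator hNm.compl) UnivMeas.measurable_val]
    refine lintegral_congr_ae ?_
    have hcompl : ∀ᵐ b ∂(UnivMeas.lift κ a), b ∉ UnivMeas.val ⁻¹' N :=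
      measure_eq_zero_iff_ae_notMem.1 hN0'
    filter_upwards [hcompl] with b hb
    have hb' : b.val ∉ N := hb
    rw [indicator_of_mem (by simpa using hb')]
    exact heq b.val hb'

/-- Measurable points make this event measurable. It lets the current state be treated as fixed
while the new memory is integrated out. -/
theorem UnivMeas.ae_graph_val_fst {α β : Type*} [MeasurableSpace α] [MeasurableSpace β]
    [MeasurableSingletonClass α] (κ : Kernel (UnivMeas α) β) [IsMarkovKernel κ]
    (a : UnivMeas α) : ∀ᵐ p ∂(UnivMeas.graph κ a), p.val.1 = a.val := by
  have hs : MeasurableSet {p : UnivMeas (α × β) | p.val.1 = a.val} :=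
    (measurable_fst.comp UnivMeas.measurable_val) (measurableSet_singleton a.val)
  rw [ae_iff]
  change UnivMeas.extend ((κ a).map (fun b => (a.val, b))) _ = _
  rw [UnivMeas.extend_apply _ (by exact hs.compl),
    Measure.map_apply₀ measurable_prodMk_left.aemeasurable
      (UnivMeas.measurableSet_iff.1 (by exact hs.compl) _ inferInstance)]
  convert measure_empty (μ := κ a)
  ext b
  simp only [mem_preimage, mem_ofPred_eq, mem_empty_iff_false, iff_false, not_not]
  rfl

/-! ### Integrals along a lifting -/

/-- The right marginal only enters through the lower integral of a function that need not be
measurable: averaging over the left component with the conditional kernel yields a measurable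
minorant. -/
theorem IsLifting.lintegral_le {X₁ X₂ : Type*} [MeasurableSpace X₁] [StandardBorelSpace X₁]
    [MeasurableSpace X₂] {R : Set (X₁ × X₂)} {δ : ℝ≥0} {W : Measure (X₁ × X₂)}
    [IsProbabilityMeasure W] {Δ : Measure X₁} {Θ : Measure X₂} (h : IsLifting R δ W Δ Θ)
    (hR : MeasurableSet R) {f : X₁ → ℝ≥0∞} (hf : Measurable f) (hf1 : ∀ x, f x ≤ 1)
    {G : X₂ → ℝ≥0∞} (hfG : ∀ x₁ x₂, (x₁, x₂) ∈ R → f x₁ ≤ G x₂) :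
    ∫⁻ x, f x ∂Δ ≤ truncOne (∫⁻ x, G x ∂Θ + δ) := by
  have hfst : W.map Prod.fst = Δ := by
    ext s hs
    rw [Measure.map_apply measurable_fst hs, ← h.left s hs, prod_univ]
  -- Disintegration conditions on the first coordinate, so the coupling is swapped to condition on
  -- the abstract state.
  have hswap : (W.map Prod.swap).fst = Θ := by
    ext s hs
    rw [Measure.fst_apply hs, Measure.map_apply measurable_swap (measurable_fst hs),
      ← h.right s hs, univ_prod]
    rfl
  have hWp : IsProbabilityMeasure (W.map Prod.swap) :=
    Measure.isProbabilityMeasure_map measurable_swap.aemeasurable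
  have hne : Nonempty X₁ := (nonempty_of_isProbabilityMeasure W).map Prod.fst
  have hRc : W Rᶜ ≤ δ := by
    rw [prob_compl_eq_one_sub hR]
    exact tsub_le_iff_tsub_le.1 h.rel
  have hfW : ∫⁻ x, f x ∂Δ = ∫⁻ p, f p.1 ∂W := by
    rw [← hfst, lintegral_map hf measurable_fst]
  have hff : Measurable fun p : X₁ × X₂ => f p.1 := hf.comp measurable_fst
  refine le_min ?_ ?_
  · rw [hfW]
    calc ∫⁻ p, f p.1 ∂W ≤ ∫⁻ _, 1 ∂W := lintegral_mono fun p => hf1 p.1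
      _ = 1 := by simp
  · rw [hfW, ← lintegral_add_compl _ hR]
    refine add_le_add ?_ ?_
    · have hg : Measurable (R.indicator fun p : X₁ × X₂ => f p.1) := hff.indicator hR
      calc ∫⁻ p in R, f p.1 ∂W = ∫⁻ p, R.indicator (fun p => f p.1) p ∂W :=
            (lintegral_indicator hR _).symm
        _ = ∫⁻ p, R.indicator (fun p => f p.1) p.swap ∂(W.map Prod.swap) := by
            exact (lintegral_map (hg.comp measurable_swap) measurable_swap).symm
        _ = ∫⁻ x₂, ∫⁻ x₁, R.indicator (fun p => f p.1) (x₁, x₂)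
              ∂((W.map Prod.swap).condKernel x₂) ∂Θ := by
            rw [← hswap]
            exact (Measure.lintegral_condKernel (hg.comp measurable_swap)).symm
        _ ≤ ∫⁻ x₂, G x₂ ∂Θ := by
            -- For fixed `x₂`, the integrand is bounded on `R` by the constant `G x₂` and vanishes
            -- off `R`; the lower integral is monotone without measurability of `G`.
            refine lintegral_mono fun x₂ => ?_
            calc ∫⁻ x₁, R.indicator (fun p => f p.1) (x₁, x₂) ∂((W.map Prod.swap).condKernel x₂)
                ≤ ∫⁻ _, G x₂ ∂((W.map Prod.swap).condKernel x₂) := by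
                  refine lintegral_mono fun x₁ => ?_
                  by_cases hx : (x₁, x₂) ∈ R
                  · simpa [hx] using hfG x₁ x₂ hx
                  · simp [hx]
              _ = G x₂ := by simp
    · calc ∫⁻ p in Rᶜ, f p.1 ∂W ≤ ∫⁻ _ in Rᶜ, 1 ∂W := lintegral_mono fun p => hf1 p.1
        _ ≤ δ := by simpa using hRc

/-! ### Reachability for Markov chains read by an automaton -/

theorem DFA.acceptOr_le_one {α Q : Type*} (A : DFA α Q) {q : Q} {v : ℝ≥0∞} (hv : v ≤ 1) :
    A.acceptOr q v ≤ 1 :=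
  max_le (indicator_le_self' (s := A.accept) (f := (1 : Q → ℝ≥0∞)) (fun _ _ => zero_le) q) hv

theorem DFA.acceptOr_of_mem {α Q : Type*} (A : DFA α Q) {q : Q} (hq : q ∈ A.accept) {v : ℝ≥0∞}
    (hv : v ≤ 1) : A.acceptOr q v = 1 :=
  le_antisymm (A.acceptOr_le_one hv) (by simp [DFA.acceptOr, hq])

theorem DFA.acceptOr_of_notMem {α Q : Type*} (A : DFA α Q) {q : Q} (hq : q ∉ A.accept)
    (v : ℝ≥0∞) : A.acceptOr q v = v := by
  simp [DFA.acceptOr, hq]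

/-- The location after reading the letters `ω 0, …, ω n`, frozen once an accepting location has been
reached. -/
noncomputable def DFA.frozenRun {α Q : Type*} (A : DFA α Q) (ω : ℕ → α) : ℕ → Q
  | 0 => A.step A.start (ω 0)
  | n + 1 =>
      open Classical in
      if A.frozenRun ω n ∈ A.accept then A.frozenRun ω n else A.step (A.frozenRun ω n) (ω (n + 1))

theorem DFA.frozenRun_congr {α Q : Type*} (A : DFA α Q) {ω ω' : ℕ → α} (n : ℕ)
    (h : ∀ i ≤ n, ω i = ω' i) : A.frozenRun ω n = A.frozenRun ω' n := by
  induction n with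
  | zero => simp [DFA.frozenRun, h 0 le_rfl]
  | succ n ih =>
    rw [DFA.frozenRun, DFA.frozenRun, ih fun i hi => h i (hi.trans n.le_succ), h (n + 1) le_rfl]

/-- A frozen run that never accepts is never frozen, so it is the ordinary run shifted by one
letter. The shift skips time `0`; acceptance there is recovered from `hstart`. -/
theorem DFA.exists_frozenRun_mem {α Q : Type*} (A : DFA α Q)
    (hstart : A.start ∈ A.accept → ∀ a, A.step A.start a ∈ A.accept) {ω : ℕ → α}
    (h : ∃ n, A.run ω n ∈ A.accept) : ∃ n, A.frozenRun ω n ∈ A.accept := by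
  by_contra! hno
  have heq : ∀ n, A.frozenRun ω n = A.run ω (n + 1) := by
    intro n
    induction n with
    | zero => rfl
    | succ n ih =>
      rw [DFA.frozenRun, if_neg (hno n), ih]
      rfl
  obtain ⟨n, hn⟩ := h
  cases n with
  | zero => exact hno 0 (hstart hn _)
  | succ n => exact hno n (heq n ▸ hn)

/-- The ordinary run may leave the accepting set. Freezing makes the acceptance events increase, so
that continuity from below applies. -/
theorem DFA.monotone_frozenRun_mem {α Q : Type*} (A : DFA α Q) (ω : ℕ → α) :
    Monotone fun n => A.frozenRun ω n ∈ A.accept :=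
  monotone_nat_of_le_succ fun n (hn : A.frozenRun ω n ∈ A.accept) => by
    simp [DFA.frozenRun, hn]

/-- The extension of a history by its last state. -/
def extendHistory {S : Type*} (m : ℕ) (h : Π _ : Finset.Iic m, S) : ℕ → S :=
  fun i => h ⟨min i m, Finset.mem_Iic.2 (min_le_right i m)⟩

/-- The location at time `m` depends only on the states up to `m`; this form exhibits it as a
function of the finite history, as the Markov property requires. -/
theorem DFA.frozenRun_extendHistory {α Q S : Type*} (A : DFA α Q) (ℓ : S → α) (m : ℕ) (z : ℕ → S) :
    A.frozenRun (fun t => ℓ (extendHistory m (Preorder.frestrictLe (π := fun _ => S) m z) t)) m =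
      A.frozenRun (fun t => ℓ (z t)) m := by
  refine A.frozenRun_congr m fun i hi => ?_
  simp [extendHistory, min_eq_left hi]

section Reach

variable {α Q S : Type*} [MeasurableSpace S]

/-- The probability that the automaton, started in `q` and reading the labels of the next `n`
states of the Markov chain with kernel `K` started at `s`, visits an accepting location. -/
noncomputable def DFA.reachIter (A : DFA α Q) (K : Kernel S S) (ℓ : S → α) : ℕ → Q → S → ℝ≥0∞
  | 0 => 0
  | n + 1 => fun q s =>
      ∫⁻ s', A.acceptOr (A.step q (ℓ s')) (A.reachIter K ℓ n (A.step q (ℓ s')) s') ∂K s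

theorem DFA.reachIter_le_one (A : DFA α Q) (K : Kernel S S) [IsMarkovKernel K] (ℓ : S → α)
    (n : ℕ) (q : Q) (s : S) : A.reachIter K ℓ n q s ≤ 1 := by
  induction n generalizing q s with
  | zero => exact zero_le
  | succ n ih =>
    calc A.reachIter K ℓ (n + 1) q s ≤ ∫⁻ _, 1 ∂K s :=
          lintegral_mono fun s' => A.acceptOr_le_one (ih _ s')
      _ = 1 := by simp

variable [Finite Q] [MeasurableSpace Q] [DiscreteMeasurableSpace Q]

theorem DFA.measurable_acceptOr_comp (A : DFA α Q) {v : Q → S → ℝ≥0∞}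
    (hv : ∀ q, Measurable (v q)) {T : Type*} [MeasurableSpace T] {r : T → Q} {σ : T → S}
    (hr : Measurable r) (hσ : Measurable σ) :
    Measurable fun t => A.acceptOr (r t) (v (r t) (σ t)) := by
  have h : Measurable fun p : Q × S => A.acceptOr p.1 (v p.1 p.2) :=
    measurable_from_prod_countable_right fun q =>
      (measurable_const (a := A.accept.indicator (1 : Q → ℝ≥0∞) q)).max (hv q)
  exact h.comp (hr.prodMk hσ)

theorem DFA.measurable_reachIter (A : DFA α Q) (K : Kernel S S) {ℓ : S → α}
    (hℓ : ∀ q, Measurable fun s => A.step q (ℓ s)) (n : ℕ) (q : Q) :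
    Measurable (A.reachIter K ℓ n q) := by
  induction n generalizing q with
  | zero => exact measurable_const
  | succ n ih => exact (A.measurable_acceptOr_comp ih (hℓ q) measurable_id).lintegral_kernel

theorem DFA.measurable_frozenRun (A : DFA α Q) {ℓ : S → α}
    (hℓ : ∀ q, Measurable fun s => A.step q (ℓ s)) (n : ℕ) :
    Measurable fun z : ℕ → S => A.frozenRun (fun t => ℓ (z t)) n := by
  classical
  induction n with
  | zero => exact (hℓ A.start).comp (measurable_pi_apply 0)
  | succ n ih =>
    have h : Measurable fun p : Q × S => if p.1 ∈ A.accept then p.1 else A.step p.1 (ℓ p.2) :=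
      measurable_from_prod_countable_right fun q => by
        by_cases hq : q ∈ A.accept
        · simp [hq]
        · simpa [hq] using hℓ q
    exact h.comp (ih.prodMk (measurable_pi_apply (n + 1)))

/-- The law of the Markov chain with kernel `K` started at `s₀`. -/
noncomputable def chainLaw (K : Kernel S S) [IsMarkovKernel K] (s₀ : S) : Measure (ℕ → S) :=
  Kernel.trajMeasure (X := fun _ => S) (Measure.dirac s₀)
    (fun n => K.comap (fun h : (Π _ : Finset.Iic n, S) => h ⟨n, Finset.mem_Iic.2 le_rfl⟩)
      (measurable_pi_apply _))

instance (K : Kernel S S) [IsMarkovKernel K] (s₀ : S) : IsProbabilityMeasure (chainLaw K s₀) := by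
  unfold chainLaw
  infer_instance

theorem lintegral_chainLaw_zero (K : Kernel S S) [IsMarkovKernel K] (s₀ : S) {f : S → ℝ≥0∞}
    (hf : Measurable f) : ∫⁻ z, f (z 0) ∂chainLaw K s₀ = f s₀ := by
  have hf' : Measurable fun h : (Π _ : Finset.Iic 0, S) => f (h ⟨0, Finset.mem_Iic.2 le_rfl⟩) :=
    hf.comp (measurable_pi_apply _)
  have hf0 : Measurable fun z : ℕ → S => f (z 0) := hf.comp (measurable_pi_apply 0)
  have hr : Measurable (Preorder.frestrictLe (π := fun _ : ℕ => S) 0) := by fun_prop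
  rw [chainLaw, Kernel.trajMeasure, Measure.lintegral_bind (Kernel.aemeasurable _)
    hf0.aemeasurable, Measure.map_dirac' (by fun_prop)]
  -- Restricted to the coordinates up to time `0`, the trajectory kernel started at time `0` is the
  -- identity.
  have hval : ∀ x : (Π _ : Finset.Iic 0, S), ∫⁻ z, f (z 0) ∂Kernel.traj (X := fun _ => S)
      (fun n => K.comap (fun h : (Π _ : Finset.Iic n, S) => h ⟨n, Finset.mem_Iic.2 le_rfl⟩)
      (measurable_pi_apply _)) 0 x = f (x ⟨0, Finset.mem_Iic.2 le_rfl⟩) := by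
    intro x
    have h := lintegral_map (μ := Kernel.traj (X := fun _ => S)
      (fun n => K.comap (fun h : (Π _ : Finset.Iic n, S) => h ⟨n, Finset.mem_Iic.2 le_rfl⟩)
      (measurable_pi_apply _)) 0 x) hf' hr
    rw [← Kernel.map_apply _ hr, Kernel.traj_map_frestrictLe, Kernel.partialTraj_self,
      Kernel.id_apply, lintegral_dirac' _ hf'] at h
    exact h.symm
  simp_rw [hval]
  rw [lintegral_dirac' _ hf']
  rfl

/-- The Markov property: history and next state have as joint law the composition-product of the
history law with `K` at the last state. `F` sees the whole history because the frozen location does.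
-/
theorem lintegral_chainLaw_succ (K : Kernel S S) [IsMarkovKernel K] (s₀ : S) (m : ℕ)
    {F : (Π _ : Finset.Iic m, S) × S → ℝ≥0∞} (hF : Measurable F) :
    ∫⁻ z, F (Preorder.frestrictLe (π := fun _ => S) m z, z (m + 1)) ∂chainLaw K s₀ =
      ∫⁻ z, ∫⁻ s, F (Preorder.frestrictLe (π := fun _ => S) m z, s) ∂K (z m) ∂chainLaw K s₀ := by
  have hr : Measurable (Preorder.frestrictLe (π := fun _ : ℕ => S) m) := by fun_prop
  have hK : Measurable fun h : (Π _ : Finset.Iic m, S) => h ⟨m, Finset.mem_Iic.2 le_rfl⟩ :=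
    measurable_pi_apply _
  have h := Kernel.map_frestrictLe_trajMeasure_compProd_eq_map_trajMeasure (X := fun _ => S)
    (μ₀ := Measure.dirac s₀)
    (κ := fun n => K.comap (fun h : (Π _ : Finset.Iic n, S) => h ⟨n, Finset.mem_Iic.2 le_rfl⟩)
      (measurable_pi_apply _)) (a := m)
  have h1 := lintegral_map (μ := chainLaw K s₀) hF (hr.prodMk (measurable_pi_apply (m + 1)))
  have h2 := Measure.lintegral_compProd (μ := (chainLaw K s₀).map (Preorder.frestrictLe m))
    (κ := K.comap _ hK) hF
  rw [lintegral_map (Measurable.lintegral_kernel_prod_right' hF) hr] at h2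
  rw [← h1]
  exact (congrArg (fun ν => ∫⁻ p, F p ∂ν) h).symm.trans h2

theorem measurable_extendHistory (m : ℕ) :
    Measurable (extendHistory m : (Π _ : Finset.Iic m, S) → ℕ → S) :=
  measurable_pi_lambda _ fun _ => measurable_pi_apply _

/-- Trades one step of the forward run for one step of the backward recursion. Given the history up
to `m`, a non-accepting location moves by an ordinary step and the conditional integral is the
recursion itself; at an accepting location the right integrand is already `1`. -/
theorem DFA.lintegral_acceptOr_frozenRun_succ_le (A : DFA α Q) (K : Kernel S S) [IsMarkovKernel K]
    {ℓ : S → α} (hℓ : ∀ q, Measurable fun s => A.step q (ℓ s)) (s₀ : S) (m k : ℕ) :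
    ∫⁻ z, A.acceptOr (A.frozenRun (fun t => ℓ (z t)) (m + 1))
        (A.reachIter K ℓ k (A.frozenRun (fun t => ℓ (z t)) (m + 1)) (z (m + 1))) ∂chainLaw K s₀ ≤
      ∫⁻ z, A.acceptOr (A.frozenRun (fun t => ℓ (z t)) m)
        (A.reachIter K ℓ (k + 1) (A.frozenRun (fun t => ℓ (z t)) m) (z m)) ∂chainLaw K s₀ := by
  classical
  let r : (Π _ : Finset.Iic m, S) × S → Q := fun p =>
    A.frozenRun (fun t => ℓ (extendHistory m p.1 t)) m
  have hr : Measurable r :=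
    (A.measurable_frozenRun hℓ m).comp ((measurable_extendHistory m).comp measurable_fst)
  let r' : (Π _ : Finset.Iic m, S) × S → Q := fun p =>
    if r p ∈ A.accept then r p else A.step (r p) (ℓ p.2)
  have hr' : Measurable r' := by
    have hstep : Measurable fun p : Q × S => A.step p.1 (ℓ p.2) :=
      measurable_from_prod_countable_right hℓ
    exact Measurable.ite (hr (Set.Finite.measurableSet (Set.toFinite A.accept))) hr
      (hstep.comp (hr.prodMk measurable_snd))
  let F : (Π _ : Finset.Iic m, S) × S → ℝ≥0∞ := fun p =>
    A.acceptOr (r' p) (A.reachIter K ℓ k (r' p) p.2)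
  have hF : Measurable F :=
    A.measurable_acceptOr_comp (A.measurable_reachIter K hℓ k) hr' measurable_snd
  have hrz : ∀ z s, r (Preorder.frestrictLe (π := fun _ => S) m z, s) =
      A.frozenRun (fun t => ℓ (z t)) m := fun z _ => A.frozenRun_extendHistory ℓ m z
  calc _ = ∫⁻ z, F (Preorder.frestrictLe (π := fun _ => S) m z, z (m + 1)) ∂chainLaw K s₀ := by
        refine lintegral_congr fun z => ?_
        simp only [F, r', hrz, DFA.frozenRun]
    _ = ∫⁻ z, ∫⁻ s, F (Preorder.frestrictLe (π := fun _ => S) m z, s) ∂K (z m) ∂chainLaw K s₀ :=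
        lintegral_chainLaw_succ K s₀ m hF
    _ ≤ _ := by
        refine lintegral_mono fun z => ?_
        simp only [F, r', hrz]
        by_cases hq : A.frozenRun (fun t => ℓ (z t)) m ∈ A.accept
        · simp only [hq, if_true]
          rw [A.acceptOr_of_mem hq (A.reachIter_le_one K ℓ (k + 1) _ _)]
          calc _ ≤ ∫⁻ _, 1 ∂K (z m) :=
                lintegral_mono fun s => A.acceptOr_le_one (A.reachIter_le_one K ℓ k _ _)
            _ = 1 := by simp
        · simp only [hq, if_false]
          rw [A.acceptOr_of_notMem hq]
          exact le_rfl

/-- The probability that the automaton accepts a trajectory of the chain is bounded by the limit of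
the probabilities that it does so within a given number of steps. -/
theorem DFA.chainLaw_accept_le (A : DFA α Q)
    (hstart : A.start ∈ A.accept → ∀ a, A.step A.start a ∈ A.accept)
    (K : Kernel S S) [IsMarkovKernel K] {ℓ : S → α}
    (hℓ : ∀ q, Measurable fun s => A.step q (ℓ s)) (s₀ : S) :
    chainLaw K s₀ {z | ∃ n, A.run (fun t => ℓ (z t)) n ∈ A.accept} ≤
      ⨆ n, A.acceptOr (A.step A.start (ℓ s₀)) (A.reachIter K ℓ n (A.step A.start (ℓ s₀)) s₀) := by
  have hsub : {z | ∃ n, A.run (fun t => ℓ (z t)) n ∈ A.accept} ⊆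
      ⋃ n, {z : ℕ → S | A.frozenRun (fun t => ℓ (z t)) n ∈ A.accept} := fun z hz =>
    mem_iUnion.2 (A.exists_frozenRun_mem hstart hz)
  have hmono : Monotone fun n => {z : ℕ → S | A.frozenRun (fun t => ℓ (z t)) n ∈ A.accept} :=
    fun m n hmn z hz => A.monotone_frozenRun_mem (fun t => ℓ (z t)) hmn hz
  refine (measure_mono hsub).trans ?_
  rw [hmono.measure_iUnion]
  refine iSup_mono fun n => ?_
  -- The `m` forward steps are traded one by one, the total horizon `m + k` staying constant. With
  -- `k = 0` the integrand dominates the indicator of acceptance at time `m`; at forward time `0`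
  -- only the initial state remains.
  have hdown : ∀ m k, ∫⁻ z, A.acceptOr (A.frozenRun (fun t => ℓ (z t)) m)
      (A.reachIter K ℓ k (A.frozenRun (fun t => ℓ (z t)) m) (z m)) ∂chainLaw K s₀ ≤
        ∫⁻ z, A.acceptOr (A.frozenRun (fun t => ℓ (z t)) 0)
          (A.reachIter K ℓ (m + k) (A.frozenRun (fun t => ℓ (z t)) 0) (z 0)) ∂chainLaw K s₀ := by
    intro m
    induction m with
    | zero => intro k; rw [zero_add]
    | succ m ih =>
      intro k
      refine (A.lintegral_acceptOr_frozenRun_succ_le K hℓ s₀ m k).trans ((ih (k + 1)).trans ?_)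
      rw [Nat.add_right_comm, Nat.add_assoc]
  have hset : MeasurableSet {z : ℕ → S | A.frozenRun (fun t => ℓ (z t)) n ∈ A.accept} :=
    A.measurable_frozenRun hℓ n (Set.Finite.measurableSet (Set.toFinite A.accept))
  calc chainLaw K s₀ {z | A.frozenRun (fun t => ℓ (z t)) n ∈ A.accept}
      = ∫⁻ z, {z | A.frozenRun (fun t => ℓ (z t)) n ∈ A.accept}.indicator 1 z ∂chainLaw K s₀ :=
        (lintegral_indicator_one hset).symm
    _ ≤ ∫⁻ z, A.acceptOr (A.frozenRun (fun t => ℓ (z t)) n)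
          (A.reachIter K ℓ 0 (A.frozenRun (fun t => ℓ (z t)) n) (z n)) ∂chainLaw K s₀ :=
        lintegral_mono fun z => le_max_left _ _
    _ ≤ _ := hdown n 0
    _ = _ := by
        exact lintegral_chainLaw_zero K s₀ (f := fun s => A.acceptOr (A.step A.start (ℓ s))
          (A.reachIter K ℓ n (A.step A.start (ℓ s)) s))
          (A.measurable_acceptOr_comp (A.measurable_reachIter K hℓ n) (hℓ _) measurable_id)

end Reach

/-! ### The bound along the simulation relation -/

section Bound

variable {X U Y XC X' U' AP Q : Type*} [MeasurableSpace X] [StandardBorelSpace X]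
  [MeasurableSpace U] [MeasurableSpace XC] [StandardBorelSpace XC] [MeasurableSpace X']
  [MeasurableSpace U'] [MeasurableSpace Y] [MeasurableSpace Q]

/-- The step law is a mixture, over the new memory and the input, of the laws of `(x', c')` with
`x'` drawn from `M.trans (x, u)`; a bound uniform in both is preserved by averaging. -/
theorem ControlStrategy.lintegral_stepKernel_le (C : ControlStrategy X U XC) (M : GMDP X U Y)
    (x : X) (c : XC) {f : X × XC → ℝ≥0∞} (hf : Measurable f) {b : ℝ≥0∞}
    (hb : ∀ u c', ∫⁻ x', f (x', c') ∂M.trans (x, u) ≤ b) :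
    ∫⁻ p, f p ∂C.stepKernel M (UnivMeas.mk (x, c)) ≤ b := by
  rw [ControlStrategy.stepKernel, Kernel.lintegral_comp _ _ _ hf]
  refine (lintegral_mono_ae (g := fun _ => b) ?_).trans (by simp)
  filter_upwards [UnivMeas.ae_graph_val_fst C.memoryKernel (UnivMeas.mk (x, c))] with p hp
  have hpx : p.val.1.1 = x := by rw [hp]; rfl
  have hfc : Measurable fun x' => f (x', p.val.2) := hf.comp measurable_prodMk_right
  rw [Kernel.lintegral_prod_deterministic _ _ _ hf, ControlStrategy.stateKernel,
    Kernel.lintegral_comp _ _ _ hfc,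
    Kernel.lintegral_deterministic_prod _ _ _ hfc.lintegral_kernel]
  refine (lintegral_mono (g := fun _ => b) fun u => ?_).trans (by simp)
  rw [hpx]
  exact hb u _

variable [MetricSpace Y]

/-- At a single point `(x, q)` a constant policy realises any input law. Hence `ν` may depend
arbitrarily on the concrete state and input, and the interface `I` need not be measurable. -/
theorem GMDP.truncOne_le_optimisticOp (M' : GMDP X' U' Y) (A : DFA (Set AP) Q) (L : Y → Set AP)
    (ε δ : ℝ≥0) (V : X' → Q → ℝ≥0∞) (x : X') (q : Q) (ν : Measure U') [IsProbabilityMeasure ν] :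
    truncOne (∫⁻ x', ⨆ q' ∈ A.ambiguousStep L ε q (M'.out x'), A.acceptOr q' (V x' q')
      ∂(M'.transMeas x ν) + δ) ≤ M'.optimisticOp A L ε δ V x q :=
  le_iSup₂_of_le (Kernel.const _ ν) inferInstance le_rfl

variable [Finite Q] [DiscreteMeasurableSpace Q]

/-- The bound must hold for all related pairs, locations and memories at once, since one transition
changes them all. The loss `δ` of each step is absorbed by the operator. -/
theorem reachIter_le_optimisticIter (C : ControlStrategy X U XC) (M : GMDP X U Y)
    (M' : GMDP X' U' Y) (A : DFA (Set AP) Q) {L : Y → Set AP}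
    (hL : ∀ q, Measurable fun y => A.step q (L y)) {ε δ : ℝ≥0}
    {I : U × X × X' → ProbabilityMeasure U'} {R : Set (X × X')}
    {W : Kernel (U × X × X') (X × X')} [IsMarkovKernel W] (hR : MeasurableSet R)
    (hdist : ∀ x x', (x, x') ∈ R → dist (M.out x) (M'.out x') ≤ ε)
    (hW : ∀ x x', (x, x') ∈ R → ∀ u, IsLifting R δ (W (u, x, x')) (M.trans (x, u))
      (M'.transMeas x' (I (u, x, x') : Measure U')))
    (n : ℕ) (q : Q) {x : X} {x' : X'} (hx : (x, x') ∈ R) (c : XC) :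
    A.reachIter (UnivMeas.lift (C.stepKernel M)) (fun s => L (M.out s.val.1)) n q
      (UnivMeas.mk (x, c)) ≤ M'.optimisticIter A L ε δ n x' q := by
  induction n generalizing q x x' c with
  | zero => exact le_rfl
  | succ n ih =>
    have hℓ : ∀ q, Measurable fun s : UnivMeas (X × XC) => A.step q (L (M.out s.val.1)) :=
      fun q => (hL q).comp
        (M.measurable_out.comp (measurable_fst.comp UnivMeas.measurable_val))
    -- The coupling integrates measurable functions on `X`, while the recursion is only universally
    -- measurable in the state; a measurable minorant with the same integral replaces it.
    obtain ⟨f, hf, hfle, hint⟩ := UnivMeas.exists_measurable_le_lintegral_lift (C.stepKernel M)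
      (UnivMeas.mk (x, c)) (A.measurable_acceptOr_comp
        (A.measurable_reachIter (UnivMeas.lift (C.stepKernel M)) hℓ n) (hℓ q) measurable_id)
    rw [DFA.reachIter]
    refine hint.trans_le (C.lintegral_stepKernel_le M x c hf fun u c' => ?_)
    have hop : M'.optimisticIter A L ε δ (n + 1) =
        M'.optimisticOp A L ε δ (M'.optimisticIter A L ε δ n) :=
      Function.iterate_succ_apply' _ _ _
    rw [hop]
    refine le_trans ?_ (M'.truncOne_le_optimisticOp A L ε δ (M'.optimisticIter A L ε δ n) x' q
      (I (u, x, x') : Measure U'))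
    refine (hW x x' hx u).lintegral_le hR (hf.comp measurable_prodMk_right)
      (fun y => (hfle (y, c')).trans (A.acceptOr_le_one (A.reachIter_le_one _ _ n _ _)))
      fun y y' hy => (hfle (y, c')).trans ?_
    -- The witness is the location really reached: `M.out y` lies in the closed `ε`-ball around
    -- `M'.out y'`.
    exact le_iSup₂_of_le (A.step q (L (M.out y))) ⟨_, ⟨_, hdist y y' hy, rfl⟩, rfl⟩
      (max_le_max le_rfl (ih _ hy c'))

end Bound

/-! ### The optimistic bound for every strategy -/

theorem mainTheorem7
    {X' : Type u₁} [TopologicalSpace X'] [PolishSpace X'] [MeasurableSpace X'] [BorelSpace X']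
    {U' : Type u₂} [TopologicalSpace U'] [PolishSpace U'] [MeasurableSpace U'] [BorelSpace U']
    {XC' : Type u₃} [TopologicalSpace XC'] [PolishSpace XC'] [MeasurableSpace XC']
    [BorelSpace XC']
    {Y : Type u₄} [MetricSpace Y] [MeasurableSpace Y] [BorelSpace Y]
    {AP : Type u₅} [Finite AP]
    {Q : Type u₆} [Finite Q] [MeasurableSpace Q] [DiscreteMeasurableSpace Q]
    (M' : GMDP X' U' Y) (L : Y → Set AP) (hL : Measurable L) (ψ : ScLTL AP)
    (A : DFA (Set AP) Q) (hA : A.Recognizes ψ)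
    (hstart : A.start ∈ A.accept → ∀ a, A.step A.start a ∈ A.accept)
    (ε δ : ℝ≥0) (C' : ControlStrategy X' U' XC') :
    OptimisticallySatisfies.{u₁, u₂, u₃, u₄, u₅, u₇, u₈, u₉} M' C' L ψ ε δ
      (M'.optimisticValue A L ε δ) := by
  intro X _ _ _ _ U _ _ _ _ M ⟨I, R, W, hWm, hR, hinit, hW⟩ XC _ _ _ _ C
  have hstep : ∀ q, Measurable fun y => A.step q (L y) := fun q =>
    (measurable_of_finite (A.step q)).comp hL
  have hℓ : ∀ q, Measurable fun s : UnivMeas (X × XC) => A.step q (L (M.out s.val.1)) :=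
    fun q => (hstep q).comp (M.measurable_out.comp (measurable_fst.comp UnivMeas.measurable_val))
  -- `C.law M` is by definition the law of the chain with the lifted step kernel, and `hA` turns
  -- satisfaction into acceptance.
  have hsat : C.satProb M L ψ = chainLaw (UnivMeas.lift (C.stepKernel M))
      (UnivMeas.mk (M.init, C.init))
      {z | ∃ n, A.run (fun t => L (M.out (z t).val.1)) n ∈ A.accept} :=
    congrArg (C.law M) (Set.ext fun z => hA _)
  rw [hsat]
  refine (A.chainLaw_accept_le hstart (UnivMeas.lift (C.stepKernel M)) hℓ _).trans
    (iSup_le fun n => ?_)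
  -- The initial states are related, so the location after the true first letter is a candidate in
  -- the outer maximum.
  refine le_iSup₂_of_le (A.step A.start (L (M.out M.init)))
    ⟨_, ⟨_, (hW _ _ hinit).1, rfl⟩, rfl⟩ (max_le_max le_rfl ?_)
  exact (reachIter_le_optimisticIter C M M' A hstep hR (fun x x' hx => (hW x x' hx).1)
    (fun x x' hx => (hW x x' hx).2) n _ hinit C.init).trans
    (le_iSup (fun l => M'.optimisticIter A L ε δ l M'.init _) n)
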